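/- Let $\mathbb D(0,r)=\{z\in\mathbb C:|z|<r\}$, $\mathbb D=\mathbb D(0,1)$, and let $dA=dx\,dy/\pi$ be the normalized area measure on $\mathbb C$. For $0<r<1$ and a polynomial $f$ with complex coefficients put $$ \Phi_f(z,r)=\left((1-|z|^2)\,|f(z)|-1_{\mathbb D(0,r)}(z)\right)^2,\qquad z\in\mathbb D, $$ $$ \rho_{\mathbb H,r}(f)=\frac{\int_{\mathbb D(0,r)}\Phi_f(z,r)\,\frac{dA(z)}{1-|z|^2}}{\int_{\mathbb D(0,r)}\frac{dA(z)}{1-|z|^2}},\qquad \rho^*_{\mathbb H,r}(f)=\frac{\int_{\mathbb D}\Phi_f(z,r)\,\frac{dA(z)}{1-|z|^2}}{\int_{\mathbb D(0,r)}\frac{dA(z)}{1-|z|^2}} . $$ Define the hyperbolic discrepancy density and the tight hyperbolic discrepancy density by $$ \rho_{\mathbb H}=\liminf_{r\to1^-}\,\inf_f\,\rho_{\mathbb H,r}(f),\qquad \rho^*_{\mathbb H}=\liminf_{r\to1^-}\,\inf_f\,\rho^*_{\mathbb H,r}(f), $$ where both infima are over all polynomials $f$ with complex coefficients. **Theorem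 1.2.** $\rho_{\mathbb H}=\rho^*_{\mathbb H}$. -/

import Mathlib

open MeasureTheory Filter Topology

noncomputable section

/-- The normalized area measure `dA = dx dy / π` on the complex plane. -/
def normArea : Measure ℂ := (ENNReal.ofReal Real.pi)⁻¹ • (volume : Measure ℂ)

/-- The hyperbolic discrepancy function
`Φ_f(z, r) = ((1 - |z|²) |f(z)| - 1_{𝔻(0,r)}(z))²`. -/
def hypDiscrepancy (f : ℂ → ℂ) (z : ℂ) (r : ℝ) : ℝ :=
  ((1 - ‖z‖ ^ 2) * ‖f z‖ - (Metric.ball (0 : ℂ) r).indicator (fun _ => (1 : ℝ)) z) ^ 2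

/-- The integral of `dA(z) / (1 - |z|²)` over the disc `𝔻(0,r)`. -/
def hypNormalizer (r : ℝ) : ℝ :=
  ∫ z in Metric.ball (0 : ℂ) r, 1 / (1 - ‖z‖ ^ 2) ∂normArea

/-- The functional `ρ_{ℍ,r}(f)`: the normalized integral of `Φ_f(·, r)` over `𝔻(0,r)`. -/
def rhoHr (r : ℝ) (f : Polynomial ℂ) : ℝ :=
  (∫ z in Metric.ball (0 : ℂ) r,
    hypDiscrepancy (fun w => f.eval w) z r / (1 - ‖z‖ ^ 2) ∂normArea) / hypNormalizer r

/-- The functional `ρ*_{ℍ,r}(f)`: the integral of `Φ_f(·, r)` is now over the whole unit disc,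
with the same normalization. -/
def rhoHrStar (r : ℝ) (f : Polynomial ℂ) : ℝ :=
  (∫ z in Metric.ball (0 : ℂ) 1,
    hypDiscrepancy (fun w => f.eval w) z r / (1 - ‖z‖ ^ 2) ∂normArea) / hypNormalizer r

/-- The hyperbolic discrepancy density `ρ_ℍ`: the lower limit, as `r` tends to `1` from below, of
the infimum over all polynomials of `ρ_{ℍ,r}`. -/
def rhoH : ℝ := liminf (fun r : ℝ => ⨅ f : Polynomial ℂ, rhoHr r f) (𝓝[<] (1 : ℝ))

/-- The tight hyperbolic discrepancy density `ρ*_ℍ`. -/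
def rhoHStar : ℝ := liminf (fun r : ℝ => ⨅ f : Polynomial ℂ, rhoHrStar r f) (𝓝[<] (1 : ℝ))

end

open Metric Set

/-! One inequality is monotonicity of the integral. For the other, replace `f` by its dilation
`f(rz)`. Rescaling turns its tight functional into `r⁻²` times an integral over the disc of radius
`r`, with weight `1 - |z|²/r²` and cutoff at radius `r²`. Compared with the integrand of `rhoHr r
f`, this costs a factor `1 + ε` and errors from the smaller weight inside radius `r²` and from the
missing indicator on the annulus (`scaledDiscrepancy_le`). These errors integrate to `O_ε(1)`
uniformly in `r` and `f`, while the normalizer `-log(1 - r²)` diverges, so they vanish in the limit.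
-/

instance isAddHaarMeasure_normArea : normArea.IsAddHaarMeasure :=
  Measure.IsAddHaarMeasure.smul _ (by simp) (by simp [Real.pi_pos])

/-! ### Hyperbolic area of discs -/

lemma normArea_real_ball_one : normArea.real (ball (0 : ℂ) 1) = 1 := by
  have hpi : ENNReal.ofReal Real.pi ≠ 0 := by simp [Real.pi_pos]
  have h : (NNReal.pi : ENNReal) = ENNReal.ofReal Real.pi := by
    rw [← NNReal.coe_real_pi, ENNReal.ofReal_coe_nnreal]
  simp [normArea, Measure.real, h, ENNReal.toReal_ofReal Real.pi_pos.le, Real.pi_ne_zero]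

lemma one_sub_mul_sq_pos {c s x : ℝ} (hc : 0 < c) (hs : c * s ^ 2 ≤ 1) (hx : 0 ≤ x) (hxs : x < s) :
    0 < 1 - c * x ^ 2 := by
  have : x ^ 2 < s ^ 2 := by gcongr
  nlinarith [mul_lt_mul_of_pos_left this hc]

lemma integral_ball_inv_one_sub_mul_sq {c s : ℝ} (hc : 0 < c) (hs : 0 ≤ s) (hcs : c * s ^ 2 < 1) :
    ∫ z in ball (0 : ℂ) s, 1 / (1 - c * ‖z‖ ^ 2) ∂normArea = -Real.log (1 - c * s ^ 2) / c := by
  have h1 : ∫ z in ball (0 : ℂ) s, 1 / (1 - c * ‖z‖ ^ 2) ∂normArea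
      = ∫ z : ℂ, (Iio s).indicator (fun y : ℝ => 1 / (1 - c * y ^ 2)) ‖z‖ ∂normArea := by
    rw [← integral_indicator measurableSet_ball]
    congr 1 with z
    simp [indicator]
  have hpos : ∀ x ∈ Icc (0 : ℝ) s, 0 < 1 - c * x ^ 2 := by
    intro x hx
    have : x ^ 2 ≤ s ^ 2 := by have := hx.1; have := hx.2; gcongr
    nlinarith [mul_le_mul_of_nonneg_left this hc.le]
  have h2 : ∫ y in Ioi (0 : ℝ), y ^ (Module.finrank ℝ ℂ - 1) •
        (Iio s).indicator (fun y : ℝ => 1 / (1 - c * y ^ 2)) y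
      = ∫ y in (0 : ℝ)..s, y * (1 / (1 - c * y ^ 2)) := by
    rw [intervalIntegral.integral_of_le hs, integral_Ioc_eq_integral_Ioo, ← Ioi_inter_Iio,
      ← setIntegral_indicator measurableSet_Iio]
    congr 1 with y
    simp [indicator, Complex.finrank_real_complex]
  have h3 : ∫ y in (0 : ℝ)..s, y * (1 / (1 - c * y ^ 2)) = -Real.log (1 - c * s ^ 2) / (2 * c) := by
    have hd : ∀ x ∈ uIcc (0 : ℝ) s, HasDerivAt (fun y => -Real.log (1 - c * y ^ 2) / (2 * c))
        (x * (1 / (1 - c * x ^ 2))) x := by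
      intro x hx
      rw [uIcc_of_le hs] at hx
      have hx' := hpos x hx
      have := ((((hasDerivAt_pow 2 x).const_mul c).const_sub 1).log hx'.ne').neg.div_const (2 * c)
      refine this.congr_deriv ?_
      field_simp
      norm_num [mul_comm]
    rw [intervalIntegral.integral_eq_sub_of_hasDerivAt hd]
    · simp
    · apply ContinuousOn.intervalIntegrable
      rw [uIcc_of_le hs]
      exact continuousOn_id.mul (continuousOn_const.div (by fun_prop) fun x hx => (hpos x hx).ne')
  rw [h1, integral_fun_norm_addHaar, normArea_real_ball_one, h2, h3]
  simp [Complex.finrank_real_complex]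
  field_simp

lemma hypNormalizer_eq {r : ℝ} (hr : 0 ≤ r) (hr1 : r < 1) :
    hypNormalizer r = -Real.log (1 - r ^ 2) := by
  simpa [hypNormalizer] using
    integral_ball_inv_one_sub_mul_sq one_pos hr (by nlinarith : 1 * r ^ 2 < 1)

lemma hypNormalizer_pos {r : ℝ} (hr : 0 < r) (hr1 : r < 1) : 0 < hypNormalizer r := by
  rw [hypNormalizer_eq hr.le hr1]
  exact neg_pos.2 (Real.log_neg (by nlinarith) (by nlinarith))

lemma tendsto_hypNormalizer : Tendsto hypNormalizer (𝓝[<] 1) atTop := by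
  have h : Tendsto (fun r : ℝ => 1 - r ^ 2) (𝓝[<] 1) (𝓝[>] 0) := by
    refine tendsto_nhdsWithin_iff.2 ⟨?_, ?_⟩
    · have : Tendsto (fun r : ℝ => 1 - r ^ 2) (𝓝 1) (𝓝 (1 - 1 ^ 2)) :=
        (by fun_prop : Continuous fun r : ℝ => 1 - r ^ 2).tendsto 1
      simpa using this.mono_left nhdsWithin_le_nhds
    · filter_upwards [Ioo_mem_nhdsLT (zero_lt_one' ℝ)] with r hr
      have := hr.1
      have := hr.2
      simp only [mem_Ioi]
      nlinarith
  refine (tendsto_neg_atBot_atTop.comp (Real.tendsto_log_nhdsGT_zero.comp h)).congr' ?_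
  filter_upwards [Ioo_mem_nhdsLT (zero_lt_one' ℝ)] with r hr
  simp [hypNormalizer_eq hr.1.le hr.2]

/-- The discrepancy integrand for the disc of radius `c ^ (-1/2)`, divided by its weight. -/
noncomputable def scaledDiscrepancy (c s : ℝ) (f : ℂ → ℂ) (z : ℂ) : ℝ :=
  ((1 - c * ‖z‖ ^ 2) * ‖f z‖ - (ball (0 : ℂ) s).indicator (fun _ => (1 : ℝ)) z) ^ 2 /
    (1 - c * ‖z‖ ^ 2)

lemma scaledDiscrepancy_nonneg {c s R : ℝ} (hc : 0 < c) (hR : c * R ^ 2 ≤ 1) (f : ℂ → ℂ) {z : ℂ}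
    (hz : z ∈ ball (0 : ℂ) R) : 0 ≤ scaledDiscrepancy c s f z :=
  div_nonneg (sq_nonneg _) (one_sub_mul_sq_pos hc hR (norm_nonneg z) (by simpa using hz)).le

lemma integrableOn_ball_of_continuous {g : ℂ → ℝ} (hg : Continuous g) (R : ℝ) :
    IntegrableOn g (ball (0 : ℂ) R) normArea :=
  (hg.continuousOn.integrableOn_compact (isCompact_closedBall 0 R)).mono_set ball_subset_closedBall

lemma integrableOn_ball_inv_one_sub_mul_sq {c s : ℝ} (hc : 0 < c) (hcs : c * s ^ 2 < 1) :
    IntegrableOn (fun z : ℂ => 1 / (1 - c * ‖z‖ ^ 2)) (ball 0 s) normArea := by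
  refine IntegrableOn.mono_set (ContinuousOn.integrableOn_compact
    (isCompact_closedBall (0 : ℂ) s) ?_) ball_subset_closedBall
  refine continuousOn_const.div (by fun_prop) fun z hz => ?_
  have hz : ‖z‖ ≤ s := by simpa using hz
  have : ‖z‖ ^ 2 ≤ s ^ 2 := by gcongr
  nlinarith [mul_le_mul_of_nonneg_left this hc.le]

/-- Once the square is expanded, the only term with the weight in a denominator lives on `ball 0 s`,
where the weight is bounded below. Hence `R` may reach the radius at which the weight vanishes. -/
lemma integrableOn_scaledDiscrepancy {c s R : ℝ} (hc : 0 < c) (hs : c * s ^ 2 < 1)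
    (hR : c * R ^ 2 ≤ 1) {f : ℂ → ℂ} (hf : Continuous f) :
    IntegrableOn (scaledDiscrepancy c s f) (ball 0 R) normArea := by
  have h1 : IntegrableOn (fun z : ℂ => (1 - c * ‖z‖ ^ 2) * ‖f z‖ ^ 2) (ball 0 R) normArea :=
    integrableOn_ball_of_continuous (by fun_prop) R
  have h2 : IntegrableOn ((ball (0 : ℂ) s).indicator fun z => 2 * ‖f z‖) (ball 0 R) normArea :=
    (integrableOn_ball_of_continuous (by fun_prop) R).indicator measurableSet_ball
  have h3 : IntegrableOn ((ball (0 : ℂ) s).indicator fun z => 1 / (1 - c * ‖z‖ ^ 2))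
      (ball 0 R) normArea :=
    ((integrable_indicator_iff measurableSet_ball).2
      (integrableOn_ball_inv_one_sub_mul_sq hc hs)).integrableOn
  refine ((h1.sub h2).add h3).congr_fun (fun z hz => ?_) measurableSet_ball
  have hpos := one_sub_mul_sq_pos hc hR (norm_nonneg z) (by simpa using hz)
  by_cases hzs : z ∈ ball (0 : ℂ) s
  · simp only [Pi.add_apply, Pi.sub_apply, scaledDiscrepancy, indicator_of_mem hzs]
    field_simp
    ring
  · simp only [Pi.add_apply, Pi.sub_apply, scaledDiscrepancy, indicator_of_notMem hzs]
    field_simp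
    ring

lemma rhoHr_eq (r : ℝ) (f : Polynomial ℂ) :
    rhoHr r f = (∫ z in ball (0 : ℂ) r, scaledDiscrepancy 1 r (fun w => f.eval w) z ∂normArea) /
      hypNormalizer r := by
  simp [rhoHr, hypDiscrepancy, scaledDiscrepancy]

lemma rhoHrStar_eq (r : ℝ) (f : Polynomial ℂ) :
    rhoHrStar r f =
      (∫ z in ball (0 : ℂ) 1, scaledDiscrepancy 1 r (fun w => f.eval w) z ∂normArea) /
      hypNormalizer r := by
  simp [rhoHrStar, hypDiscrepancy, scaledDiscrepancy]

lemma rhoHr_nonneg {r : ℝ} (hr : 0 < r) (hr1 : r < 1) (f : Polynomial ℂ) : 0 ≤ rhoHr r f := by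
  rw [rhoHr_eq]
  exact div_nonneg (setIntegral_nonneg measurableSet_ball fun z hz =>
    scaledDiscrepancy_nonneg one_pos (by nlinarith) _ hz) (hypNormalizer_pos hr hr1).le

lemma rhoHr_le_rhoHrStar {r : ℝ} (hr : 0 < r) (hr1 : r < 1) (f : Polynomial ℂ) :
    rhoHr r f ≤ rhoHrStar r f := by
  rw [rhoHr_eq, rhoHrStar_eq]
  refine div_le_div_of_nonneg_right ?_ (hypNormalizer_pos hr hr1).le
  refine setIntegral_mono_set
    (integrableOn_scaledDiscrepancy one_pos (by nlinarith) (by norm_num) f.continuous) ?_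
    (ball_subset_ball hr1.le).eventuallyLE
  filter_upwards [ae_restrict_mem measurableSet_ball] with z hz
  exact scaledDiscrepancy_nonneg one_pos (by norm_num) _ hz

/-- The zero polynomial bounds the infimum by `1`, which later makes a multiplicative error
additive. -/
lemma rhoHr_zero {r : ℝ} (hr : 0 < r) (hr1 : r < 1) : rhoHr r 0 = 1 := by
  rw [rhoHr_eq, div_eq_one_iff_eq (hypNormalizer_pos hr hr1).ne', hypNormalizer]
  refine setIntegral_congr_fun measurableSet_ball fun z hz => ?_
  simp [scaledDiscrepancy, indicator_of_mem hz]

/-! ### Cost of dilating -/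

/-- Inside the support of the indicator, shrinking the weight from `x` to `y` costs little. -/
lemma sq_sub_one_div_le {x y a : ℝ} (hy : 0 < y) (hyx : y ≤ x) :
    (y * a - 1) ^ 2 / y ≤ (x * a - 1) ^ 2 / x + (1 / y - 1 / x) := by
  have hx : 0 < x := hy.trans_le hyx
  -- The cross term `-2a` does not depend on the weight.
  have e1 : (y * a - 1) ^ 2 / y = y * a ^ 2 - 2 * a + 1 / y := by field_simp; ring
  have e2 : (x * a - 1) ^ 2 / x = x * a ^ 2 - 2 * a + 1 / x := by field_simp; ring
  rw [e1, e2]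
  nlinarith [mul_le_mul_of_nonneg_right hyx (sq_nonneg a)]

/-- Outside the support of the indicator, shrinking the weight from `x` to `y` costs little. -/
lemma sq_sub_zero_div_le {x y a ε : ℝ} (hε : 0 < ε) (hy : 0 < y) (hyx : y ≤ x) :
    (y * a - 0) ^ 2 / y ≤ (1 + ε) * ((x * a - 1) ^ 2 / x) + (1 + 1 / ε) * (1 / x) := by
  have hx : 0 < x := hy.trans_le hyx
  have e1 : (y * a - 0) ^ 2 / y = y * a ^ 2 := by field_simp; ring
  -- Young's inequality for `x a = (x a - 1) + 1`, with its defect written as a square.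
  have e2 : (1 + ε) * ((x * a - 1) ^ 2 / x) + (1 + 1 / ε) * (1 / x)
      = x * a ^ 2 + (ε * (x * a - 1) - 1) ^ 2 / (ε * x) := by field_simp; ring
  rw [e1, e2]
  have : 0 ≤ (ε * (x * a - 1) - 1) ^ 2 / (ε * x) := by positivity
  nlinarith [mul_le_mul_of_nonneg_right hyx (sq_nonneg a)]

lemma scaledDiscrepancy_le {r ε : ℝ} (hr : 0 < r) (hr1 : r < 1) (hε : 0 < ε) (f : ℂ → ℂ) {z : ℂ}
    (hz : z ∈ ball (0 : ℂ) r) :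
    scaledDiscrepancy (r ^ 2)⁻¹ (r ^ 2) f z ≤ (1 + ε) * scaledDiscrepancy 1 r f z +
      ((ball (0 : ℂ) (r ^ 2)).indicator
        (fun z => 1 / (1 - (r ^ 2)⁻¹ * ‖z‖ ^ 2) - 1 / (1 - 1 * ‖z‖ ^ 2)) z +
      (1 + 1 / ε) * ((ball (0 : ℂ) (r ^ 2))ᶜ.indicator (fun z => 1 / (1 - 1 * ‖z‖ ^ 2)) z)) := by
  have hr2 : 1 ≤ (r ^ 2)⁻¹ := (one_le_inv₀ (by positivity)).2 (by nlinarith)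
  have hy : 0 < 1 - (r ^ 2)⁻¹ * ‖z‖ ^ 2 :=
    one_sub_mul_sq_pos (by positivity) (inv_mul_cancel₀ (by positivity)).le (norm_nonneg z)
      (by simpa using hz)
  have hyx : 1 - (r ^ 2)⁻¹ * ‖z‖ ^ 2 ≤ 1 - 1 * ‖z‖ ^ 2 := by gcongr
  have hD : 0 ≤ scaledDiscrepancy 1 r f z :=
    scaledDiscrepancy_nonneg one_pos (by nlinarith) f hz
  by_cases h : z ∈ ball (0 : ℂ) (r ^ 2)
  · have := sq_sub_one_div_le (a := ‖f z‖) hy hyx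
    simp only [scaledDiscrepancy, indicator_of_mem h, indicator_of_mem hz,
      indicator_of_notMem (notMem_compl_iff.2 h)] at hD ⊢
    nlinarith [mul_nonneg hε.le hD]
  · have := sq_sub_zero_div_le (a := ‖f z‖) hε hy hyx
    simp only [scaledDiscrepancy, indicator_of_notMem h, indicator_of_mem hz,
      indicator_of_mem (mem_compl h)] at hD ⊢
    linarith

lemma setIntegral_scaledDiscrepancy_le {r ε : ℝ} (hr : 0 < r) (hr1 : r < 1) (hε : 0 < ε)
    {f : ℂ → ℂ} (hf : Continuous f) :
    ∫ z in ball (0 : ℂ) r, scaledDiscrepancy (r ^ 2)⁻¹ (r ^ 2) f z ∂normArea ≤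
      (1 + ε) * ∫ z in ball (0 : ℂ) r, scaledDiscrepancy 1 r f z ∂normArea +
        (2 + 1 / ε) * Real.log 2 := by
  have hr2 : r ^ 2 < r := by nlinarith
  have hr21 : r ^ 2 < 1 := by linarith
  have hr4 : (r ^ 2) ^ 2 < 1 := by nlinarith [sq_nonneg r]
  have hc : 0 < (r ^ 2)⁻¹ := by positivity
  have hcs : (r ^ 2)⁻¹ * (r ^ 2) ^ 2 = r ^ 2 := by field_simp
  have hsub : ball (0 : ℂ) (r ^ 2) ⊆ ball 0 r := ball_subset_ball hr2.le
  have i1 := integrableOn_scaledDiscrepancy one_pos (by nlinarith : 1 * r ^ 2 < 1)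
    (by nlinarith : 1 * r ^ 2 ≤ 1) hf
  have i0 := integrableOn_scaledDiscrepancy hc (by linarith : (r ^ 2)⁻¹ * (r ^ 2) ^ 2 < 1)
    (inv_mul_cancel₀ (by positivity : r ^ 2 ≠ 0)).le hf
  have j1 := integrableOn_ball_inv_one_sub_mul_sq hc (by linarith : (r ^ 2)⁻¹ * (r ^ 2) ^ 2 < 1)
  have j2 := integrableOn_ball_inv_one_sub_mul_sq one_pos (by linarith : 1 * (r ^ 2) ^ 2 < 1)
  have j3 := integrableOn_ball_inv_one_sub_mul_sq one_pos (by linarith : 1 * r ^ 2 < 1)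
  have i2 : IntegrableOn ((ball (0 : ℂ) (r ^ 2)).indicator
      (fun z => 1 / (1 - (r ^ 2)⁻¹ * ‖z‖ ^ 2) - 1 / (1 - 1 * ‖z‖ ^ 2))) (ball 0 r) normArea :=
    ((integrable_indicator_iff measurableSet_ball).2 (j1.sub j2)).integrableOn
  have i3 : IntegrableOn ((ball (0 : ℂ) (r ^ 2))ᶜ.indicator (fun z => 1 / (1 - 1 * ‖z‖ ^ 2)))
      (ball 0 r) normArea := j3.indicator measurableSet_ball.compl
  have v1 := integral_ball_inv_one_sub_mul_sq hc (by positivity)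
    (by linarith : (r ^ 2)⁻¹ * (r ^ 2) ^ 2 < 1)
  have v2 := integral_ball_inv_one_sub_mul_sq one_pos (by positivity)
    (by linarith : 1 * (r ^ 2) ^ 2 < 1)
  have v3 := integral_ball_inv_one_sub_mul_sq one_pos hr.le (by linarith : 1 * r ^ 2 < 1)
  -- `1 - r⁴ = (1 + r²)(1 - r²) ≤ 2(1 - r²)`: the source of every `log 2`.
  have hlog : Real.log (1 - (r ^ 2) ^ 2) ≤ Real.log 2 + Real.log (1 - r ^ 2) := by
    rw [← Real.log_mul two_ne_zero (by linarith)]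
    exact Real.log_le_log (by linarith) (by nlinarith)
  have hneg : Real.log (1 - r ^ 2) ≤ 0 := Real.log_nonpos (by linarith) (by nlinarith [sq_nonneg r])
  have e2 : ∫ z in ball (0 : ℂ) r, (ball (0 : ℂ) (r ^ 2)).indicator
      (fun z => 1 / (1 - (r ^ 2)⁻¹ * ‖z‖ ^ 2) - 1 / (1 - 1 * ‖z‖ ^ 2)) z ∂normArea
      ≤ Real.log 2 := by
    rw [setIntegral_indicator measurableSet_ball, inter_eq_right.2 hsub, integral_sub j1 j2, v1, v2,
      hcs, div_inv_eq_mul, one_mul, div_one]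
    -- Beyond `log 2` there remains `(1 - r²) log(1 - r²) ≤ 0`.
    nlinarith
  have e3 : ∫ z in ball (0 : ℂ) r, (ball (0 : ℂ) (r ^ 2))ᶜ.indicator
      (fun z => 1 / (1 - 1 * ‖z‖ ^ 2)) z ∂normArea ≤ Real.log 2 := by
    rw [setIntegral_indicator measurableSet_ball.compl, ← sdiff_eq,
      setIntegral_sdiff measurableSet_ball j3 hsub, v2, v3]
    simp only [one_mul, div_one]
    linarith
  calc _ ≤ ∫ z in ball (0 : ℂ) r, ((1 + ε) * scaledDiscrepancy 1 r f z +
      ((ball (0 : ℂ) (r ^ 2)).indicator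
        (fun z => 1 / (1 - (r ^ 2)⁻¹ * ‖z‖ ^ 2) - 1 / (1 - 1 * ‖z‖ ^ 2)) z +
      (1 + 1 / ε) * ((ball (0 : ℂ) (r ^ 2))ᶜ.indicator
        (fun z => 1 / (1 - 1 * ‖z‖ ^ 2)) z))) ∂normArea :=
        setIntegral_mono_on i0 ((i1.const_mul _).add (i2.add (i3.const_mul _)))
          measurableSet_ball fun z hz => scaledDiscrepancy_le hr hr1 hε f hz
    _ ≤ _ := by
        rw [integral_add (i1.const_mul _) (by exact i2.add (i3.const_mul _)),
          integral_add i2 (i3.const_mul _), integral_const_mul, integral_const_mul]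
        have : 0 < 1 + 1 / ε := by positivity
        nlinarith [mul_le_mul_of_nonneg_left e3 this.le]

/-- Dilating a polynomial turns the discrepancy over the disc of radius `r` into a tight one. -/
lemma rhoHrStar_comp_dilation_le {r ε : ℝ} (hr : 0 < r) (hr1 : r < 1) (hε : 0 < ε)
    (f : Polynomial ℂ) :
    rhoHrStar r (f.comp (Polynomial.C (r : ℂ) * Polynomial.X)) ≤
      (r ^ 2)⁻¹ * ((1 + ε) * rhoHr r f + (2 + 1 / ε) * Real.log 2 / hypNormalizer r) := by
  have hN := hypNormalizer_pos hr hr1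
  have key : ∫ z in ball (0 : ℂ) 1, scaledDiscrepancy 1 r
      (fun w => (f.comp (Polynomial.C (r : ℂ) * Polynomial.X)).eval w) z ∂normArea
      = (r ^ 2)⁻¹ * ∫ z in ball (0 : ℂ) r,
        scaledDiscrepancy (r ^ 2)⁻¹ (r ^ 2) (fun w => f.eval w) z ∂normArea := by
    have h := Measure.setIntegral_comp_smul normArea
      (scaledDiscrepancy (r ^ 2)⁻¹ (r ^ 2) fun w => f.eval w) (ball (0 : ℂ) 1) hr.ne'
    rw [_root_.smul_unitBall_of_pos hr, Complex.finrank_real_complex, abs_of_pos (by positivity),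
      smul_eq_mul] at h
    rw [← h]
    refine setIntegral_congr_fun measurableSet_ball fun z _ => ?_
    have e1 : (r ^ 2)⁻¹ * ‖r • z‖ ^ 2 = 1 * ‖z‖ ^ 2 := by
      rw [norm_smul, Real.norm_of_nonneg hr.le]
      field_simp
    have e2 : (ball (0 : ℂ) (r ^ 2)).indicator (fun _ => (1 : ℝ)) (r • z) =
        (ball (0 : ℂ) r).indicator (fun _ => (1 : ℝ)) z := by
      refine indicator_eq_indicator ?_ rfl
      rw [mem_ball_zero_iff, mem_ball_zero_iff, norm_smul, Real.norm_of_nonneg hr.le, sq,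
        mul_lt_mul_iff_right₀ hr]
    simp only [scaledDiscrepancy, e1, e2]
    simp
  rw [rhoHrStar_eq, rhoHr_eq, key, mul_div_assoc, mul_div_assoc' (1 + ε), ← add_div]
  gcongr
  exact setIntegral_scaledDiscrepancy_le hr hr1 hε f.continuous

/-! ### Infima and the limit -/

lemma bddBelow_range_rhoHr {r : ℝ} (hr : 0 < r) (hr1 : r < 1) : BddBelow (range (rhoHr r)) :=
  ⟨0, forall_mem_range.2 (rhoHr_nonneg hr hr1)⟩

lemma bddBelow_range_rhoHrStar {r : ℝ} (hr : 0 < r) (hr1 : r < 1) :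
    BddBelow (range (rhoHrStar r)) :=
  ⟨0, forall_mem_range.2 fun f => (rhoHr_nonneg hr hr1 f).trans (rhoHr_le_rhoHrStar hr hr1 f)⟩

lemma iInf_rhoHr_nonneg {r : ℝ} (hr : 0 < r) (hr1 : r < 1) : 0 ≤ ⨅ f, rhoHr r f :=
  le_ciInf (rhoHr_nonneg hr hr1)

lemma iInf_rhoHr_le_one {r : ℝ} (hr : 0 < r) (hr1 : r < 1) : ⨅ f, rhoHr r f ≤ 1 :=
  (ciInf_le (bddBelow_range_rhoHr hr hr1) 0).trans (rhoHr_zero hr hr1).le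

lemma iInf_rhoHr_le_iInf_rhoHrStar {r : ℝ} (hr : 0 < r) (hr1 : r < 1) :
    ⨅ f, rhoHr r f ≤ ⨅ f, rhoHrStar r f :=
  ciInf_mono (bddBelow_range_rhoHr hr hr1) (rhoHr_le_rhoHrStar hr hr1)

lemma iInf_rhoHrStar_le {r ε : ℝ} (hr : 0 < r) (hr1 : r < 1) (hε : 0 < ε) :
    ⨅ f, rhoHrStar r f ≤
      (r ^ 2)⁻¹ * ((1 + ε) * (⨅ f, rhoHr r f) + (2 + 1 / ε) * Real.log 2 / hypNormalizer r) := by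
  have hr2 : (0 : ℝ) < r ^ 2 := by positivity
  -- Solved for `rhoHr r f`, the dilation bound becomes a lower bound uniform in `f`.
  have h : ((⨅ f, rhoHrStar r f) * r ^ 2 - (2 + 1 / ε) * Real.log 2 / hypNormalizer r) / (1 + ε)
      ≤ ⨅ f, rhoHr r f := by
    refine le_ciInf fun f => ?_
    have := (ciInf_le (bddBelow_range_rhoHrStar hr hr1) _).trans
      (rhoHrStar_comp_dilation_le hr hr1 hε f)
    rw [le_inv_mul_iff₀ hr2] at this
    rw [div_le_iff₀ (by positivity)]
    linarith
  rw [div_le_iff₀ (by positivity)] at h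
  rw [le_inv_mul_iff₀ hr2]
  linarith

lemma eventually_iInf_rhoHrStar_le_add {η : ℝ} (hη : 0 < η) :
    ∀ᶠ r in 𝓝[<] (1 : ℝ), ⨅ f, rhoHrStar r f ≤ (⨅ f, rhoHr r f) + η := by
  -- With `ε = η / 2` the total error tends to `η / 2 < η`.
  have hε : 0 < η / 2 := by positivity
  have h1 : Tendsto (fun r : ℝ => (r ^ 2)⁻¹) (𝓝[<] 1) (𝓝 1) := by
    have : ContinuousAt (fun r : ℝ => (r ^ 2)⁻¹) 1 := by
      apply ContinuousAt.inv₀ (by fun_prop)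
      norm_num
    simpa [ContinuousAt] using this.tendsto.mono_left nhdsWithin_le_nhds
  have h2 : Tendsto (fun r : ℝ => (2 + 1 / (η / 2)) * Real.log 2 / hypNormalizer r) (𝓝[<] 1)
      (𝓝 0) := tendsto_hypNormalizer.const_div_atTop _
  have h3 : Tendsto (fun r : ℝ => ((r ^ 2)⁻¹ * (1 + η / 2) - 1) +
      (r ^ 2)⁻¹ * ((2 + 1 / (η / 2)) * Real.log 2 / hypNormalizer r)) (𝓝[<] 1)
      (𝓝 ((1 * (1 + η / 2) - 1) + 1 * 0)) :=
    ((h1.mul_const _).sub_const 1).add (h1.mul h2)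
  filter_upwards [h3.eventually_lt_const (by linarith : (1 * (1 + η / 2) - 1) + 1 * 0 < η),
    Ioo_mem_nhdsLT (zero_lt_one' ℝ)] with r hr ⟨hr0, hr1⟩
  have hstar := iInf_rhoHrStar_le hr0 hr1 hε
  have hone := iInf_rhoHr_le_one hr0 hr1
  have hr2 : 1 ≤ (r ^ 2)⁻¹ := (one_le_inv₀ (by positivity)).2 (by nlinarith)
  have : 0 ≤ (r ^ 2)⁻¹ * (1 + η / 2) - 1 := by nlinarith
  nlinarith [mul_le_mul_of_nonneg_left hone this]

/-- The hyperbolic discrepancy density equals its tight version. -/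
theorem theorem1p2 : rhoH = rhoHStar := by
  have hmem : ∀ᶠ r in 𝓝[<] (1 : ℝ), r ∈ Ioo (0 : ℝ) 1 := Ioo_mem_nhdsLT zero_lt_one
  have hb : IsBoundedUnder (· ≥ ·) (𝓝[<] (1 : ℝ)) fun r => ⨅ f, rhoHr r f :=
    isBoundedUnder_of_eventually_ge (hmem.mono fun r hr => iInf_rhoHr_nonneg hr.1 hr.2)
  have ha : IsBoundedUnder (· ≤ ·) (𝓝[<] (1 : ℝ)) fun r => ⨅ f, rhoHr r f :=
    isBoundedUnder_of_eventually_le (hmem.mono fun r hr => iInf_rhoHr_le_one hr.1 hr.2)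
  have hb' : IsBoundedUnder (· ≥ ·) (𝓝[<] (1 : ℝ)) fun r => ⨅ f, rhoHrStar r f :=
    isBoundedUnder_of_eventually_ge (hmem.mono fun r hr =>
      (iInf_rhoHr_nonneg hr.1 hr.2).trans (iInf_rhoHr_le_iInf_rhoHrStar hr.1 hr.2))
  have ha' : IsBoundedUnder (· ≤ ·) (𝓝[<] (1 : ℝ)) fun r => ⨅ f, rhoHrStar r f := by
    refine isBoundedUnder_of_eventually_le (a := 1 + 1) ?_
    filter_upwards [hmem, eventually_iInf_rhoHrStar_le_add one_pos] with r hr h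
    linarith [iInf_rhoHr_le_one hr.1 hr.2]
  apply le_antisymm
  · exact liminf_le_liminf
      (hmem.mono fun r hr => iInf_rhoHr_le_iInf_rhoHrStar hr.1 hr.2) hb ha'.isCoboundedUnder_ge
  · refine le_of_forall_pos_le_add fun η hη => ?_
    rw [rhoH, rhoHStar, ← liminf_add_const _ _ _ ha.isCoboundedUnder_ge hb]
    refine liminf_le_liminf (eventually_iInf_rhoHrStar_le_add hη) hb' ?_
    exact (isBoundedUnder_of_eventually_le (a := 1 + η) (hmem.mono fun r hr => by
      linarith [iInf_rhoHr_le_one hr.1 hr.2])).isCoboundedUnder_ge
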